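/- Lemma (mixed derivatives of ground state properties). For every $\gamma>0$ there is a function $g:\mathbb N\to\mathbb R$, depending only on $\gamma$, with $g(k)=\mathcal O(k\log k)$ as $k\to\infty$, such that the following holds for all $n,m,k\in\mathbb N$, every Pauli string $P\in\{I,X,Y,Z\}^{\otimes n}$ and every $\alpha_P\in\mathbb R$. Let $H(x)$, $x\in[-1,1]^m$, be a family of $n$-qubit Hamiltonians (Hermitian $2^n\times 2^n$ matrices), $k$ times continuously differentiable on $[-1,1]^m$, such that for every $x\in[-1,1]^m$ the spectral gap of $H(x)$ is at least $\gamma$, i.e. every eigenvalue of $H(x)$ other than the smallest one (which may be degenerate) exceeds the smallest one by at least $\gamma$. Let $\rho(x)=\lim_{\beta\to\infty}e^{-\beta H(x)}/\mathrm{tr}(e^{-\beta H(x)})$ be the ground state, and let $\|\cdot\|_\infty$ be the spectral norm. Then $x\mapsto\alpha_P\,\mathrm{tr}(P\rho(x))$ is $k$ times continuously differentiable on $[-1,1]^m$, and: (1) Let $i_1,\dots,i_k\in\{1,\dots,m\}$, not necessarily distinct. If $$\left\|\frac{\partial^{|C|}H}{\prod_{j\in C}\partial x_{i_j}}(x)\right\|_\infty\le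 1\qquad\text{for all nonempty } C\subseteq\{1,\dots,k\}\text{ and all } x\in[-1,1]^m,$$ then for all $x\in[-1,1]^m$ $$\left|\frac{\partial^k}{\partial x_{i_1}\cdots\partial x_{i_k}}\,\alpha_P\,\mathrm{tr}(P\rho(x))\right|\le|\alpha_P|\,2^{g(k)}=|\alpha_P|\,2^{\mathcal O(k\log k)}.$$ (2) Write $\|f\|_{W^{k,\infty}}=\max_{|a|\le k}\sup_{x\in[-1,1]^m}\|\partial^a f(x)\|$, with $a\in\mathbb N_0^m$ and with the spectral norm inside for matrix-valued $f$. If $\sup_{x\in[-1,1]^m}\|\partial^a H(x)\|_\infty\le1$ for all multi-indices $a$ with $1\le|a|\le k$ (in particular, if $\|H\|_{W^{k,\infty}}\le1$), then $$\|\alpha_P\,\mathrm{tr}(P\rho(\cdot))\|_{W^{k,\infty}}\le|\alpha_P|\,2^{g(k)}=|\alpha_P|\,2^{\mathcal O(k\log k)}.$$ -/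

import Mathlib

open Filter Topology Asymptotics
open scoped Matrix.Norms.L2Operator ENNReal

noncomputable section

namespace GroundState

/-- Operators on `n` qubits, written in the computational basis. Throughout, `‖·‖` on
this type is the spectral (operator) norm. -/
abbrev QubitOp (n : ℕ) : Type := Matrix (Fin n → Fin 2) (Fin n → Fin 2) ℂ

/-- Labels of the single-qubit Pauli matrices. -/
inductive Pauli : Type
  | I | X | Y | Z

/-- The single-qubit Pauli matrices. -/
def Pauli.toMatrix : Pauli → Matrix (Fin 2) (Fin 2) ℂ
  | .I => !![1, 0; 0, 1]
  | .X => !![0, 1; 1, 0]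
  | .Y => !![0, -Complex.I; Complex.I, 0]
  | .Z => !![1, 0; 0, -1]

/-- The Pauli string `P 0 ⊗ P 1 ⊗ ⋯ ⊗ P (n - 1)`. -/
def pauliString {n : ℕ} (P : Fin n → Pauli) : QubitOp n :=
  Matrix.of fun a b => ∏ j, (P j).toMatrix (a j) (b j)

/-- The Gibbs state `exp (-β A) / tr (exp (-β A))`. -/
def gibbsState {n : ℕ} (A : QubitOp n) (β : ℝ) : QubitOp n :=
  (NormedSpace.exp ((-β) • A)).trace⁻¹ • NormedSpace.exp ((-β) • A)

/-- The ground state of `A`: the zero-temperature limit of its Gibbs states. -/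
def groundState {n : ℕ} (A : QubitOp n) : QubitOp n :=
  limUnder atTop (gibbsState A)

/-- The spectral gap of `A` is at least `γ`: every eigenvalue other than the smallest one
exceeds it by at least `γ`. The smallest eigenvalue may be degenerate. -/
def HasSpectralGap {n : ℕ} (A : QubitOp n) (γ : ℝ) : Prop :=
  ∃ E₀ : ℝ, IsLeast (spectrum ℝ A) E₀ ∧ ∀ E ∈ spectrum ℝ A, E ≠ E₀ → E₀ + γ ≤ E

/-- The parameter space `[-1, 1]^m`. -/
def cube (m : ℕ) : Set (Fin m → ℝ) := Set.Icc (fun _ => -1) (fun _ => 1)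

/-- The partial derivative `∂^k f / ∂x_{i 0} ⋯ ∂x_{i (k - 1)}` on `[-1, 1]^m` (one-sided at
the boundary). The coordinates `i 0, …, i (k - 1)` need not be distinct. -/
def mixedPartial {m k : ℕ} {E : Type*} [NormedAddCommGroup E] [NormedSpace ℝ E]
    (f : (Fin m → ℝ) → E) (i : Fin k → Fin m) (x : Fin m → ℝ) : E :=
  iteratedFDerivWithin ℝ k f (cube m) x (fun j => Pi.single (i j) 1)

/-- The order-`l` seminorm `max_{|a| = l} sup_{x ∈ [-1, 1]^m} ‖∂^a f (x)‖`. -/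
def sobolevSeminorm {m : ℕ} {E : Type*} [NormedAddCommGroup E] [NormedSpace ℝ E]
    (l : ℕ) (f : (Fin m → ℝ) → E) : ℝ≥0∞ :=
  ⨆ i : Fin l → Fin m, ⨆ x ∈ cube m, ‖mixedPartial f i x‖ₑ

/-- The norm of `W^{k, ∞}([-1, 1]^m)` for `k` times continuously differentiable functions:
`max_{|a| ≤ k} sup_{x ∈ [-1, 1]^m} ‖∂^a f (x)‖`. -/
def sobolevNorm {m : ℕ} {E : Type*} [NormedAddCommGroup E] [NormedSpace ℝ E]
    (k : ℕ) (f : (Fin m → ℝ) → E) : ℝ≥0∞ :=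
  ⨆ l ∈ Set.Iic k, sobolevSeminorm l f

/-- The weighted ground state property `x ↦ α * tr (P ρ(x))`, where `ρ(x)` is the ground
state of `H x`. -/
def groundProperty {n m : ℕ} (H : (Fin m → ℝ) → QubitOp n) (P : Fin n → Pauli) (α : ℝ)
    (x : Fin m → ℝ) : ℂ :=
  (α : ℂ) * (pauliString P * groundState (H x)).trace

end GroundState

end

/-!
The ground space projection `Π(x)` of `H(x)` is the spectral projection of the smallest
eigenvalue, and the zero-temperature limit of the Gibbs states is `Π / tr Π` (`groundState_eq`).
Everything rests on the two algebraic identities `Π² = Π` and `H Π = Π H`, together with the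
reduced resolvent `G`, which inverts `H - E` on the excited subspace and has norm at most `1 / γ`.

*Regularity.* For two gapped operators the identity `(1 - Π_A) Π_B = G_A (A - E_A) Π_B` and Weyl's
inequality give first order perturbation theory with a quadratic error depending on `γ` only
(`norm_groundProj_sub_add_le`). Hence `Π` is differentiable along `H`, with derivative
`-(G H' Π + Π H' G)`. Since `E = tr (H Π) / tr Π` and `G = (H - E + Π)⁻¹ - Π` are smooth expressions
in `H` and `Π`, the smoothness of `Π` bootstraps up to that of `H` (`contDiffOn_groundProj`). The
derivative is off-diagonal, so `tr Π` is constant on the cube (`trace_groundProj_eq`) and only `Π`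
itself has to be differentiated further.

*Bounds.* By the Leibniz rule over splittings of the list of directions (`iterDeriv_mul`), a mixed
derivative `X` of `Π` satisfies `X = Π X + X Π + S` and `H X - X H + T = 0`, where `S` and `T` contain
only derivatives of `Π` of lower order and derivatives of `H` along sublists. The first equation
determines the diagonal blocks of `X` and the second one the off-diagonal blocks, which gives
`‖X‖ ≤ 2 ‖S‖ + (2 / γ) ‖T‖` (`IsIdealNorm.le_of_linearised`). Solving the recursion gives
`‖X‖ ≤ l! M ^ (2 l)` with `M = (2 + 4 / γ) (k + 1)` for derivatives of order `l ≤ k`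
(`IsIdealNorm.family_le`).

*Independence of the dimension.* The recursion only uses that the norm is compatible with
multiplication by bounded operators and that `Π` has norm at most one. It therefore also holds for
the trace norm divided by `tr Π`, which controls `tr (P X) / tr Π` for every Pauli string `P`
without any dimensional factor.
-/

namespace GroundState

/-! ### Sums over splittings of a list -/

/-- The sum of `F A B` over all ways of splitting the list `L` into a sublist `A` and its
complementary sublist `B`, indexed by sets of positions. -/
def splitSum {α M : Type*} [AddCommMonoid M] : List α → (List α → List α → M) → M
  | [], F => F [] []
  | v :: L, F => splitSum L fun A B => F (v :: A) B + F A (v :: B)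

section SplitSum

variable {α M N : Type*} [AddCommMonoid M] [AddCommMonoid N]

theorem splitSum_add (L : List α) (F G : List α → List α → M) :
    splitSum L (fun A B => F A B + G A B) = splitSum L F + splitSum L G := by
  induction L generalizing F G with
  | nil => rfl
  | cons v L ih =>
    simp only [splitSum, ← ih]
    congr 1
    funext A B
    exact add_add_add_comm _ _ _ _

theorem map_splitSum {Φ : Type*} [FunLike Φ M N] [AddMonoidHomClass Φ M N] (φ : Φ) (L : List α)
    (F : List α → List α → M) : φ (splitSum L F) = splitSum L fun A B => φ (F A B) := by
  induction L generalizing F with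
  | nil => rfl
  | cons v L ih => simp only [splitSum, ih, map_add]

theorem splitSum_right_nil (L : List α) (F : List α → List α → M) :
    splitSum L (fun A B => if B = [] then F A B else 0) = F L [] := by
  induction L generalizing F with
  | nil => simp [splitSum]
  | cons v L ih => simpa [splitSum] using ih fun A B => F (v :: A) B

theorem splitSum_left_nil (L : List α) (F : List α → List α → M) :
    splitSum L (fun A B => if A = [] then F A B else 0) = F [] L := by
  induction L generalizing F with
  | nil => simp [splitSum]
  | cons v L ih => simpa [splitSum] using ih fun A B => F A (v :: B)

/-- Splitting off the term whose first part is empty. -/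
theorem splitSum_eq_left_add (L : List α) (F : List α → List α → M) :
    splitSum L F = F [] L + splitSum L fun A B => if A = [] then 0 else F A B := by
  rw [← splitSum_left_nil L F, ← splitSum_add]
  congr 1
  funext A B
  split_ifs <;> simp

/-- Splitting off the term whose second part is empty. -/
theorem splitSum_eq_right_add (L : List α) (F : List α → List α → M) :
    splitSum L F = F L [] + splitSum L fun A B => if B = [] then 0 else F A B := by
  rw [← splitSum_right_nil L F, ← splitSum_add]
  congr 1
  funext A B
  split_ifs <;> simp

/-- Splitting off both terms with an empty part. -/
theorem splitSum_eq_left_add_right_add {L : List α} (hL : L ≠ []) (F : List α → List α → M) :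
    splitSum L F =
      F [] L + (F L [] + splitSum L fun A B => if A = [] ∨ B = [] then 0 else F A B) := by
  rw [splitSum_eq_left_add, splitSum_eq_right_add, if_neg hL]
  congr 3
  funext A B
  by_cases hA : A = [] <;> by_cases hB : B = [] <;> simp [hA, hB]

theorem splitSum_mono (L : List α) {F G : List α → List α → ℝ}
    (h : ∀ A B, A.Sublist L → B.Sublist L → A.length + B.length = L.length → F A B ≤ G A B) :
    splitSum L F ≤ splitSum L G := by
  induction L generalizing F G with
  | nil => exact h [] [] (List.Sublist.refl _) (List.Sublist.refl _) rfl
  | cons v L ih =>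
    refine ih fun A B hA hB hl => ?_
    exact add_le_add (h (v :: A) B (hA.cons_cons v) (hB.cons v) (by simp; omega))
      (h A (v :: B) (hA.cons v) (hB.cons_cons v) (by simp; omega))

theorem apply_splitSum_le {V : Type*} [AddCommMonoid V] (N : V → ℝ)
    (hN : ∀ x y, N (x + y) ≤ N x + N y) (L : List α) (F : List α → List α → V) :
    N (splitSum L F) ≤ splitSum L fun A B => N (F A B) := by
  induction L generalizing F with
  | nil => exact le_rfl
  | cons v L ih => exact (ih _).trans (splitSum_mono L fun A B _ _ _ => hN _ _)

/-- The Vandermonde-type identity behind `splitSum_factorial`; the shifts `a` and `b` make the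
induction work. -/
theorem splitSum_factorial_shift (L : List α) (a b : ℕ) :
    ((a + b + 1).factorial : ℝ) *
        splitSum L (fun A B => ((A.length + a).factorial : ℝ) * ((B.length + b).factorial : ℝ)) =
      a.factorial * b.factorial * (L.length + a + b + 1).factorial := by
  induction L generalizing a b with
  | nil => simp [splitSum]; ring
  | cons v L ih =>
    have h1 := ih (a + 1) b
    have h2 := ih a (b + 1)
    have e1 : a + 1 + b + 1 = (a + b + 1) + 1 := by ring
    have e2 : a + (b + 1) + 1 = (a + b + 1) + 1 := by ring
    have e3 : L.length + a + (b + 1) + 1 = L.length + (a + 1) + b + 1 := by ring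
    rw [e1, Nat.factorial_succ (a + b + 1), Nat.factorial_succ a] at h1
    rw [e2, e3, Nat.factorial_succ (a + b + 1), Nat.factorial_succ b] at h2
    simp only [splitSum, List.length_cons]
    rw [splitSum_add]
    have e4 : ∀ A : List α, A.length + 1 + a = A.length + (a + 1) := fun A => by ring
    have e5 : ∀ A : List α, A.length + 1 + b = A.length + (b + 1) := fun A => by ring
    simp only [e4, e5]
    push_cast at h1 h2 ⊢
    have h3 : ((a : ℝ) + b + 1 + 1) ≠ 0 := by positivity
    apply mul_left_cancel₀ h3
    linear_combination h1 + h2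

theorem splitSum_factorial (L : List α) :
    splitSum L (fun A B => (A.length.factorial : ℝ) * (B.length.factorial : ℝ)) =
      (L.length + 1) * L.length.factorial := by
  have := splitSum_factorial_shift L 0 0
  simpa [Nat.factorial_succ] using this

end SplitSum

/-! ### Iterated directional derivatives along a list of vectors -/

section IterDeriv

variable {E F G 𝔸 : Type*} [NormedAddCommGroup E] [NormedSpace ℝ E]
  [NormedAddCommGroup F] [NormedSpace ℝ F] [NormedAddCommGroup G] [NormedSpace ℝ G]
  [NormedRing 𝔸] [NormedAlgebra ℝ 𝔸]

/-- The iterated directional derivative of `f` within `s` along the vectors in the list, the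
head of the list being the outermost derivative. -/
noncomputable def iterDeriv (s : Set E) : List E → (E → F) → E → F
  | [], f => f
  | v :: L, f => fun x => fderivWithin ℝ (iterDeriv s L f) s x v

variable {s : Set E}

theorem iterDeriv_congr (L : List E) {f g : E → F} (h : Set.EqOn f g s) :
    Set.EqOn (iterDeriv s L f) (iterDeriv s L g) s := by
  induction L with
  | nil => exact h
  | cons v L ih =>
    intro x hx
    simp only [iterDeriv]
    rw [fderivWithin_congr ih (ih hx)]

theorem contDiffOn_iterDeriv (hs : UniqueDiffOn ℝ s) {L : List E} {n j : ℕ} {f : E → F}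
    (hf : ContDiffOn ℝ n f s) (h : L.length + j ≤ n) : ContDiffOn ℝ j (iterDeriv s L f) s := by
  induction L generalizing j with
  | nil => exact hf.of_le (by exact_mod_cast (by simpa using h))
  | cons v L ih =>
    have h1 : ContDiffOn ℝ (j + 1 : ℕ) (iterDeriv s L f) s := ih (by simp at h; omega)
    exact (h1.fderivWithin hs (by norm_cast)).clm_apply contDiffOn_const

theorem differentiableOn_iterDeriv (hs : UniqueDiffOn ℝ s) {L : List E} {n : ℕ} {f : E → F}
    (hf : ContDiffOn ℝ n f s) (h : L.length + 1 ≤ n) : DifferentiableOn ℝ (iterDeriv s L f) s :=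
  (contDiffOn_iterDeriv hs hf h).differentiableOn (by norm_num)

theorem iterDeriv_clm_comp (hs : UniqueDiffOn ℝ s) (φ : F →L[ℝ] G) {L : List E} {n : ℕ}
    {f : E → F} (hf : ContDiffOn ℝ n f s) (h : L.length ≤ n) :
    Set.EqOn (iterDeriv s L fun x => φ (f x)) (fun x => φ (iterDeriv s L f x)) s := by
  induction L with
  | nil => exact fun _ _ => rfl
  | cons v L ih =>
    intro x hx
    have ih' := ih (by simp at h; omega)
    have hd := differentiableOn_iterDeriv hs hf (L := L) (by simpa using h) x hx
    simp only [iterDeriv]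
    have hφ : HasFDerivWithinAt (fun y => φ (iterDeriv s L f y)) _ s x :=
      φ.hasFDerivAt.comp_hasFDerivWithinAt x hd.hasFDerivWithinAt
    rw [fderivWithin_congr ih' (ih' hx), hφ.fderivWithin (hs x hx)]
    rfl

theorem hasFDerivWithinAt_splitSum {α : Type*} (L : List α) {f : List α → List α → E → F}
    {f' : List α → List α → E →L[ℝ] F} {x : E}
    (h : ∀ A B, A.length + B.length = L.length → HasFDerivWithinAt (f A B) (f' A B) s x) :
    HasFDerivWithinAt (fun y => splitSum L fun A B => f A B y) (splitSum L f') s x := by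
  induction L generalizing f f' with
  | nil => exact h [] [] rfl
  | cons v L ih =>
    refine ih (f := fun A B y => f (v :: A) B y + f A (v :: B) y) fun A B hl => ?_
    exact (h (v :: A) B (by simp; omega)).add (h A (v :: B) (by simp; omega))

/-- The Leibniz rule: an iterated derivative of a product is the sum over all distributions of
the directions among the two factors. -/
theorem iterDeriv_mul (hs : UniqueDiffOn ℝ s) {L : List E} {n : ℕ} {f g : E → 𝔸}
    (hf : ContDiffOn ℝ n f s) (hg : ContDiffOn ℝ n g s) (h : L.length ≤ n) :
    Set.EqOn (iterDeriv s L fun x => f x * g x)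
      (fun x => splitSum L fun A B => iterDeriv s A f x * iterDeriv s B g x) s := by
  induction L with
  | nil => exact fun _ _ => rfl
  | cons v L ih =>
    intro x hx
    have h' : L.length + 1 ≤ n := by simpa using h
    have ih' := ih (by omega)
    have hd := hasFDerivWithinAt_splitSum (s := s) (x := x) L
      (f := fun A B y => iterDeriv s A f y * iterDeriv s B g y) fun A B hl =>
        ((differentiableOn_iterDeriv hs hf (L := A) (by omega) x hx).hasFDerivWithinAt.mul'
          (differentiableOn_iterDeriv hs hg (L := B) (by omega) x hx).hasFDerivWithinAt)
    simp only [iterDeriv]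
    rw [fderivWithin_congr ih' (ih' hx), hd.fderivWithin (hs x hx)]
    change ContinuousLinearMap.apply ℝ 𝔸 v (splitSum L _) = splitSum L _
    rw [map_splitSum]
    congr 1
    funext A B
    simp [iterDeriv, add_comm]

theorem iteratedFDerivWithin_eq_iterDeriv (hs : UniqueDiffOn ℝ s) {k : ℕ} {f : E → F}
    (hf : ContDiffOn ℝ k f s) (v : Fin k → E) :
    Set.EqOn (fun x => iteratedFDerivWithin ℝ k f s x v) (iterDeriv s (List.ofFn v) f) s := by
  induction k with
  | zero => intro x _; simp [iterDeriv]
  | succ k ih =>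
    intro x hx
    have hf' : ContDiffOn ℝ k f s := hf.of_le (by norm_cast; omega)
    have hd : DifferentiableWithinAt ℝ (iteratedFDerivWithin ℝ k f s) s x :=
      hf.differentiableOn_iteratedFDerivWithin (by norm_cast; omega) hs x hx
    have ih' := ih hf' (Fin.tail v)
    rw [List.ofFn_succ]
    have h1 : HasFDerivWithinAt (fun y => iteratedFDerivWithin ℝ k f s y (Fin.tail v)) _ s x :=
      ((ContinuousMultilinearMap.apply ℝ (fun _ : Fin k => E) F
      (Fin.tail v)).hasFDerivAt.comp_hasFDerivWithinAt x hd.hasFDerivWithinAt)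
    change iteratedFDerivWithin ℝ (k + 1) f s x v =
      fderivWithin ℝ (iterDeriv s (List.ofFn (Fin.tail v)) f) s x (v 0)
    rw [iteratedFDerivWithin_succ_apply_left, ← fderivWithin_congr ih' (ih' hx),
      h1.fderivWithin (hs x hx)]
    rfl

end IterDeriv

/-! ### Ground space projection and reduced resolvent -/

section Spectral

variable {n : ℕ} {A B : QubitOp n} {γ : ℝ}

/-- The smallest eigenvalue of a Hermitian operator. -/
noncomputable def groundEnergy (A : QubitOp n) : ℝ := sInf (spectrum ℝ A)

/-- The spectral projection of `A` onto the eigenspace of the smallest eigenvalue. -/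
noncomputable def groundProj (A : QubitOp n) : QubitOp n :=
  cfc (fun t => if t = groundEnergy A then (1 : ℝ) else 0) A

/-- The reduced resolvent of `A` at its smallest eigenvalue: the inverse of
`A - groundEnergy A` on the excited subspace, and zero on the ground space (where the
functional calculus uses `0⁻¹ = 0`). -/
noncomputable def reducedResolvent (A : QubitOp n) : QubitOp n :=
  cfc (fun t => (t - groundEnergy A)⁻¹) A

theorem continuousOn_spectrum (A : QubitOp n) (f : ℝ → ℝ) : ContinuousOn f (spectrum ℝ A) :=
  (Matrix.finite_real_spectrum (A := A)).continuousOn f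

theorem HasSpectralGap.isLeast (h : HasSpectralGap A γ) :
    IsLeast (spectrum ℝ A) (groundEnergy A) := by
  obtain ⟨E, hE, -⟩ := h
  rwa [groundEnergy, hE.csInf_eq]

theorem HasSpectralGap.le_sub (h : HasSpectralGap A γ) {t : ℝ} (ht : t ∈ spectrum ℝ A)
    (hne : t ≠ groundEnergy A) : γ ≤ t - groundEnergy A := by
  have hl := h.isLeast
  obtain ⟨E, hE, hgap⟩ := h
  have := hE.unique hl
  subst this
  linarith [hgap t ht hne]

theorem groundProj_isSelfAdjoint (A : QubitOp n) : IsSelfAdjoint (groundProj A) := by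
  unfold groundProj; exact cfc_predicate _ _

theorem reducedResolvent_isSelfAdjoint (A : QubitOp n) : IsSelfAdjoint (reducedResolvent A) := by
  unfold reducedResolvent; exact cfc_predicate _ _

theorem groundProj_mul_self (A : QubitOp n) : groundProj A * groundProj A = groundProj A := by
  unfold groundProj
  rw [← cfc_mul _ _ A (continuousOn_spectrum A _) (continuousOn_spectrum A _)]
  congr 1
  funext t
  split_ifs <;> simp

theorem reducedResolvent_mul_groundProj (A : QubitOp n) :
    reducedResolvent A * groundProj A = 0 := by
  unfold groundProj reducedResolvent
  rw [← cfc_mul _ _ A (continuousOn_spectrum A _) (continuousOn_spectrum A _),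
    ← cfc_const_zero ℝ A]
  congr 1
  funext t
  split_ifs with h <;> simp [h]

theorem groundProj_mul_reducedResolvent (A : QubitOp n) :
    groundProj A * reducedResolvent A = 0 := by
  have := congrArg star (reducedResolvent_mul_groundProj A)
  rwa [star_mul, (groundProj_isSelfAdjoint A).star_eq,
    (reducedResolvent_isSelfAdjoint A).star_eq, star_zero] at this

theorem mul_groundProj (hA : A.IsHermitian) :
    A * groundProj A = groundEnergy A • groundProj A := by
  have hA' : IsSelfAdjoint A := hA
  unfold groundProj
  nth_rw 1 [← cfc_id' ℝ A]
  rw [← cfc_mul _ _ A (continuousOn_spectrum A _) (continuousOn_spectrum A _),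
    ← cfc_smul _ _ A (continuousOn_spectrum A _)]
  congr 1
  funext t
  split_ifs with h <;> simp [h]

theorem groundProj_mul (hA : A.IsHermitian) :
    groundProj A * A = groundEnergy A • groundProj A := by
  have hA' : IsSelfAdjoint A := hA
  have := congrArg star (mul_groundProj hA)
  rwa [star_mul, (groundProj_isSelfAdjoint A).star_eq, hA'.star_eq, star_smul,
    (groundProj_isSelfAdjoint A).star_eq, star_trivial] at this

theorem reducedResolvent_mul_sub (hA : A.IsHermitian) :
    reducedResolvent A * (A - groundEnergy A • 1) = 1 - groundProj A := by
  have hA' : IsSelfAdjoint A := hA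
  have e : A - groundEnergy A • 1 = cfc (fun t => t - groundEnergy A) A := by
    rw [cfc_sub _ _ A (continuousOn_spectrum A _) (continuousOn_spectrum A _), cfc_id' ℝ A,
      cfc_const _ A, Algebra.algebraMap_eq_smul_one]
  rw [e, reducedResolvent, groundProj,
    ← cfc_mul _ _ A (continuousOn_spectrum A _) (continuousOn_spectrum A _),
    ← cfc_const_one ℝ A, ← cfc_sub _ _ A (continuousOn_spectrum A _) (continuousOn_spectrum A _)]
  congr 1
  funext t
  split_ifs with h
  · simp [h]
  · simp [inv_mul_cancel₀ (sub_ne_zero.2 h)]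

theorem sub_mul_reducedResolvent (hA : A.IsHermitian) :
    (A - groundEnergy A • 1) * reducedResolvent A = 1 - groundProj A := by
  have hA' : IsSelfAdjoint A := hA
  have := congrArg star (reducedResolvent_mul_sub hA)
  rwa [star_mul, star_sub, star_sub, star_smul, star_one, star_trivial (groundEnergy A),
    hA'.star_eq,
    (groundProj_isSelfAdjoint A).star_eq, (reducedResolvent_isSelfAdjoint A).star_eq] at this

theorem norm_groundProj_le (A : QubitOp n) : ‖groundProj A‖ ≤ 1 := by
  refine norm_cfc_le zero_le_one fun t _ => ?_
  split_ifs <;> simp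

theorem norm_one_sub_groundProj_le (hA : A.IsHermitian) : ‖1 - groundProj A‖ ≤ 1 := by
  have hA' : IsSelfAdjoint A := hA
  rw [groundProj, ← cfc_const_one ℝ A,
    ← cfc_sub _ _ A (continuousOn_spectrum A _) (continuousOn_spectrum A _)]
  refine norm_cfc_le zero_le_one fun t _ => ?_
  split_ifs <;> simp

theorem norm_reducedResolvent_le (hγ : 0 < γ) (h : HasSpectralGap A γ) :
    ‖reducedResolvent A‖ ≤ γ⁻¹ := by
  refine norm_cfc_le (by positivity) fun t ht => ?_
  by_cases hne : t = groundEnergy A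
  · simp [hne, hγ.le]
  · have := h.le_sub ht hne
    rw [norm_inv, Real.norm_of_nonneg (by linarith)]
    exact inv_anti₀ hγ this

theorem groundProj_ne_zero (hA : A.IsHermitian) (h : HasSpectralGap A γ) : groundProj A ≠ 0 := by
  intro h0
  have h1 := reducedResolvent_mul_sub hA
  have h2 := sub_mul_reducedResolvent hA
  rw [h0, sub_zero] at h1 h2
  have hu : IsUnit (A - groundEnergy A • 1) := ⟨⟨_, _, h2, h1⟩, rfl⟩
  have := h.isLeast.1
  rw [spectrum.mem_iff, Algebra.algebraMap_eq_smul_one, ← IsUnit.neg_iff, neg_sub] at this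
  exact this hu

theorem trace_groundProj_ne_zero (hA : A.IsHermitian) (h : HasSpectralGap A γ) :
    (groundProj A).trace ≠ 0 := by
  intro h0
  apply groundProj_ne_zero hA h
  open scoped ComplexOrder in
  rw [← Matrix.trace_conjTranspose_mul_self_eq_zero_iff, ← Matrix.star_eq_conjTranspose,
    (groundProj_isSelfAdjoint A).star_eq, groundProj_mul_self, h0]

/-- Weyl's inequality for the smallest eigenvalue. -/
theorem groundEnergy_le_add (hA : A.IsHermitian) (hB : B.IsHermitian)
    (hgA : HasSpectralGap A γ) (hgB : HasSpectralGap B γ) :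
    groundEnergy A ≤ groundEnergy B + ‖A - B‖ := by
  open scoped MatrixOrder in
  have hA' : IsSelfAdjoint A := hA
  have hB' : IsSelfAdjoint B := hB
  have h1 : algebraMap ℝ (QubitOp n) (groundEnergy A) ≤ A :=
    (algebraMap_le_iff_le_spectrum hA').2 fun x hx => hgA.isLeast.2 hx
  have h2 : A - B ≤ algebraMap ℝ (QubitOp n) ‖A - B‖ :=
    (hA'.sub hB').le_algebraMap_norm_self
  have h3 : algebraMap ℝ (QubitOp n) (groundEnergy A - ‖A - B‖) ≤ B := by
    rw [map_sub, sub_le_iff_le_add]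
    calc _ ≤ A := h1
      _ = B + (A - B) := by abel
      _ ≤ _ := by gcongr
  have := (algebraMap_le_iff_le_spectrum hB').1 h3 _ hgB.isLeast.1
  linarith

theorem abs_groundEnergy_sub_le (hA : A.IsHermitian) (hB : B.IsHermitian)
    (hgA : HasSpectralGap A γ) (hgB : HasSpectralGap B γ) :
    |groundEnergy A - groundEnergy B| ≤ ‖A - B‖ := by
  have h1 := groundEnergy_le_add hA hB hgA hgB
  have h2 := groundEnergy_le_add hB hA hgB hgA
  rw [norm_sub_rev] at h2
  rw [abs_le]
  constructor <;> linarith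

/-! ### The zero-temperature limit -/

/-- After the ground energy is factored out, the excited part of `exp (-β A)` is at most
`exp (-β γ)`. -/
theorem tendsto_exp_neg_smul (hγ : 0 < γ) (hA : A.IsHermitian) (h : HasSpectralGap A γ) :
    Tendsto (fun β : ℝ => Real.exp (β * groundEnergy A) • NormedSpace.exp ((-β) • A)) atTop
      (𝓝 (groundProj A)) := by
  have hA' : IsSelfAdjoint A := hA
  have hexp : ∀ β : ℝ, Real.exp (β * groundEnergy A) • NormedSpace.exp ((-β) • A) =
      cfc (fun t => Real.exp (-β * (t - groundEnergy A))) A := by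
    intro β
    have hs : IsSelfAdjoint ((-β) • A) := (IsSelfAdjoint.all (-β)).smul hA'
    rw [← CFC.real_exp_eq_normedSpace_exp hs,
      ← cfc_comp_smul (-β) Real.exp A Real.continuous_exp.continuousOn hA',
      ← cfc_smul _ _ A (continuousOn_spectrum A _)]
    congr 1
    funext t
    rw [smul_eq_mul, smul_eq_mul, ← Real.exp_add]
    ring_nf
  have hbound : ∀ β : ℝ, 0 ≤ β →
      ‖Real.exp (β * groundEnergy A) • NormedSpace.exp ((-β) • A) - groundProj A‖ ≤
        Real.exp (-(γ * β)) := by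
    intro β hβ
    rw [hexp, groundProj,
      ← cfc_sub _ _ A (continuousOn_spectrum A _) (continuousOn_spectrum A _)]
    refine norm_cfc_le (Real.exp_pos _).le fun t ht => ?_
    split_ifs with hne
    · simp [hne, Real.exp_nonneg]
    · rw [sub_zero, Real.norm_of_nonneg (Real.exp_nonneg _), Real.exp_le_exp]
      nlinarith [h.le_sub ht hne]
  rw [tendsto_iff_norm_sub_tendsto_zero]
  refine squeeze_zero' (Eventually.of_forall fun _ => norm_nonneg _)
    ((eventually_ge_atTop 0).mono hbound) ?_
  exact Real.tendsto_exp_neg_atTop_nhds_zero.comp (tendsto_id.const_mul_atTop hγ)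

theorem groundState_eq (hγ : 0 < γ) (hA : A.IsHermitian) (h : HasSpectralGap A γ) :
    groundState A = (groundProj A).trace⁻¹ • groundProj A := by
  refine Tendsto.limUnder_eq ?_
  have h1 := tendsto_exp_neg_smul hγ hA h
  have htr : Continuous fun X : QubitOp n => X.trace := continuous_id.matrix_trace
  have h2 := (((htr.tendsto _).comp h1).inv₀ (trace_groundProj_ne_zero hA h)).smul h1
  refine h2.congr fun β => ?_
  have hne : (Real.exp (β * groundEnergy A) : ℂ) ≠ 0 := by
    exact_mod_cast (Real.exp_pos _).ne'
  simp only [Function.comp_apply, gibbsState, Matrix.trace_smul]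
  ext a b
  simp only [Matrix.smul_apply, smul_eq_mul, Complex.real_smul]
  field_simp

/-! ### Trace bounds and Pauli strings -/

theorem norm_apply_le_norm (W : QubitOp n) (i : Fin n → Fin 2) : ‖W i i‖ ≤ ‖W‖ := by
  have h := Matrix.l2_opNorm_mulVec W (EuclideanSpace.single i (1 : ℂ))
  have h2 := (PiLp.norm_apply_le (WithLp.toLp 2
    (W.mulVec (EuclideanSpace.single i (1 : ℂ)).ofLp) : EuclideanSpace ℂ _) i).trans h
  simpa using h2

/-- The trace norm of an orthogonal projection is its trace. -/
theorem norm_trace_mul_groundProj_le (A W : QubitOp n) :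
    ‖(W * groundProj A).trace‖ ≤ ‖W‖ * ‖(groundProj A).trace‖ := by
  open scoped ComplexOrder in
  have hP : (groundProj A).PosSemidef := by
    have := Matrix.posSemidef_conjTranspose_mul_self (groundProj A)
    rwa [← Matrix.star_eq_conjTranspose, (groundProj_isSelfAdjoint A).star_eq,
      groundProj_mul_self] at this
  have hH := hP.isHermitian
  set U : QubitOp n := hH.eigenvectorUnitary.1
  have hUm : U ∈ unitary (QubitOp n) := hH.eigenvectorUnitary.2
  have hspec : groundProj A = U * Matrix.diagonal (fun i => (hH.eigenvalues i : ℂ)) * star U := by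
    conv_lhs => rw [hH.spectral_theorem]
    rfl
  have htr : (groundProj A).trace = ((∑ i, hH.eigenvalues i : ℝ) : ℂ) := by
    rw [hH.trace_eq_sum_eigenvalues]; simp
  have hnn : 0 ≤ ∑ i, hH.eigenvalues i := Finset.sum_nonneg fun i _ => hP.eigenvalues_nonneg i
  rw [htr, Complex.norm_of_nonneg hnn]
  have e : (W * groundProj A).trace =
      ∑ i, (star U * W * U) i i * (hH.eigenvalues i : ℂ) := by
    conv_lhs => rw [hspec, ← mul_assoc, Matrix.trace_mul_comm, ← mul_assoc, ← mul_assoc]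
    simp [Matrix.trace, Matrix.mul_diagonal]
  rw [e, Finset.mul_sum]
  refine (norm_sum_le _ _).trans (Finset.sum_le_sum fun i _ => ?_)
  rw [norm_mul, Complex.norm_of_nonneg (hP.eigenvalues_nonneg i)]
  refine mul_le_mul_of_nonneg_right ?_ (hP.eigenvalues_nonneg i)
  refine (norm_apply_le_norm _ i).trans (le_of_eq ?_)
  rw [CStarRing.norm_mul_mem_unitary _ hUm,
    CStarRing.norm_mem_unitary_mul _ (Unitary.star_mem hUm)]

theorem Pauli.conjTranspose_toMatrix (p : Pauli) : p.toMatrix.conjTranspose = p.toMatrix := by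
  cases p <;> ext i j <;> fin_cases i <;> fin_cases j <;> simp [Pauli.toMatrix]

theorem Pauli.toMatrix_mul_self (p : Pauli) : p.toMatrix * p.toMatrix = 1 := by
  cases p <;> ext i j <;> fin_cases i <;> fin_cases j <;> simp [Pauli.toMatrix]

theorem norm_pauliString_le (P : Fin n → Pauli) : ‖pauliString P‖ ≤ 1 := by
  have h : (pauliString P).conjTranspose * pauliString P = 1 := by
    ext a b
    have h1 : ∀ c, (pauliString P).conjTranspose a c * pauliString P c b =
        ∏ j, (P j).toMatrix (a j) (c j) * (P j).toMatrix (c j) (b j) := by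
      intro c
      have : ∀ j, star ((P j).toMatrix (c j) (a j)) = (P j).toMatrix (a j) (c j) := fun j =>
        congrFun (congrFun (P j).conjTranspose_toMatrix (a j)) (c j)
      simp only [pauliString, Matrix.conjTranspose_apply, Matrix.of_apply, star_prod, this,
        Finset.prod_mul_distrib]
    have h2 : ∀ j, ∑ c, (P j).toMatrix (a j) c * (P j).toMatrix c (b j) =
        (1 : Matrix (Fin 2) (Fin 2) ℂ) (a j) (b j) := fun j => by
      rw [← (P j).toMatrix_mul_self, Matrix.mul_apply]
    rw [Matrix.mul_apply, Finset.sum_congr rfl fun c _ => h1 c]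
    rw [← Fintype.prod_sum fun j c => (P j).toMatrix (a j) c * (P j).toMatrix c (b j)]
    simp only [h2, Matrix.one_apply]
    by_cases hab : a = b
    · simp [hab]
    · obtain ⟨j, hj⟩ := Function.ne_iff.1 hab
      rw [if_neg hab]
      exact Finset.prod_eq_zero (Finset.mem_univ j) (if_neg hj)
  have h3 := Matrix.l2_opNorm_conjTranspose_mul_self (pauliString P)
  rw [h, norm_one] at h3
  nlinarith [norm_nonneg (pauliString P)]

end Spectral

/-! ### Regularity of the ground space projection -/

section Perturbation

variable {n : ℕ} {A B : QubitOp n} {γ : ℝ}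

/-- The leakage of the ground space of `B` into the excited subspace of `A`. It follows from
`(A - E_A) Π_B = (E_B - E_A) Π_B - (B - A) Π_B`. -/
theorem one_sub_groundProj_mul_groundProj (hA : A.IsHermitian) (hB : B.IsHermitian) :
    (1 - groundProj A) * groundProj B =
      (groundEnergy B - groundEnergy A) •
          (reducedResolvent A * ((1 - groundProj A) * groundProj B)) -
        reducedResolvent A * (B - A) * groundProj B := by
  have h1 : reducedResolvent A * ((1 - groundProj A) * groundProj B) =
      reducedResolvent A * groundProj B := by
    rw [← mul_assoc, mul_sub, reducedResolvent_mul_groundProj, mul_one, sub_zero]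
  rw [h1]
  nth_rw 1 [← reducedResolvent_mul_sub hA]
  have h2 := congrArg (fun X => reducedResolvent A * X) (mul_groundProj hB)
  simp only [mul_smul_comm] at h2
  simp only [mul_sub, sub_mul, mul_smul_comm, mul_one, smul_mul_assoc, sub_smul, mul_assoc]
  rw [h2]
  abel

theorem norm_one_sub_groundProj_mul_groundProj_le (hγ : 0 < γ) (hA : A.IsHermitian)
    (hB : B.IsHermitian) (hgA : HasSpectralGap A γ) (hgB : HasSpectralGap B γ) :
    ‖(1 - groundProj A) * groundProj B‖ ≤ 2 * γ⁻¹ * ‖B - A‖ := by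
  have hG := norm_reducedResolvent_le hγ hgA
  have hE := abs_groundEnergy_sub_le hB hA hgB hgA
  have hQ : ‖(1 - groundProj A) * groundProj B‖ ≤ 1 :=
    (norm_mul_le _ _).trans (mul_le_one₀ (norm_one_sub_groundProj_le hA) (norm_nonneg _)
      (norm_groundProj_le B))
  have hγ' : 0 < γ⁻¹ := inv_pos.2 hγ
  rw [one_sub_groundProj_mul_groundProj hA hB]
  refine (norm_sub_le _ _).trans ?_
  have h1 : ‖(groundEnergy B - groundEnergy A) •
      (reducedResolvent A * ((1 - groundProj A) * groundProj B))‖ ≤ ‖B - A‖ * (γ⁻¹ * 1) := by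
    rw [norm_smul]
    refine mul_le_mul hE ((norm_mul_le _ _).trans ?_) (norm_nonneg _) (norm_nonneg _)
    exact mul_le_mul hG hQ (norm_nonneg _) hγ'.le
  have h2 : ‖reducedResolvent A * (B - A) * groundProj B‖ ≤ γ⁻¹ * ‖B - A‖ * 1 := by
    refine (norm_mul_le _ _).trans (mul_le_mul ((norm_mul_le _ _).trans ?_)
      (norm_groundProj_le B) (norm_nonneg _) (by positivity))
    gcongr
  linarith

theorem norm_groundProj_sub_le (hγ : 0 < γ) (hA : A.IsHermitian)
    (hB : B.IsHermitian) (hgA : HasSpectralGap A γ) (hgB : HasSpectralGap B γ) :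
    ‖groundProj B - groundProj A‖ ≤ 4 * γ⁻¹ * ‖B - A‖ := by
  have h1 := norm_one_sub_groundProj_mul_groundProj_le hγ hA hB hgA hgB
  have h2 := norm_one_sub_groundProj_mul_groundProj_le hγ hB hA hgB hgA
  rw [norm_sub_rev A B] at h2
  have h3 : groundProj B - groundProj A = (1 - groundProj A) * groundProj B -
      star ((1 - groundProj B) * groundProj A) := by
    rw [star_mul, star_sub, star_one, (groundProj_isSelfAdjoint A).star_eq,
      (groundProj_isSelfAdjoint B).star_eq]
    noncomm_ring
  rw [h3]
  refine (norm_sub_le _ _).trans ?_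
  rw [norm_star]
  linarith

/-- First order perturbation theory for the ground space projection, with a quadratic error
bound that depends on the gap only. -/
theorem norm_groundProj_sub_add_le (hγ : 0 < γ) (hA : A.IsHermitian)
    (hB : B.IsHermitian) (hgA : HasSpectralGap A γ) (hgB : HasSpectralGap B γ) :
    ‖groundProj B - groundProj A + (reducedResolvent A * (B - A) * groundProj A +
        groundProj A * (B - A) * reducedResolvent A)‖ ≤ 20 * γ⁻¹ ^ 2 * ‖B - A‖ ^ 2 := by
  have hγ' : 0 < γ⁻¹ := inv_pos.2 hγ
  have hG := norm_reducedResolvent_le hγ hgA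
  have hE := abs_groundEnergy_sub_le hB hA hgB hgA
  have hD := norm_groundProj_sub_le hγ hA hB hgA hgB
  have h1 := norm_one_sub_groundProj_mul_groundProj_le hγ hA hB hgA hgB
  have h2 := norm_one_sub_groundProj_mul_groundProj_le hγ hB hA hgB hgA
  have hid := one_sub_groundProj_mul_groundProj hA hB
  rw [norm_sub_rev A B] at h2
  have sA := (groundProj_isSelfAdjoint A).star_eq
  have sB := (groundProj_isSelfAdjoint B).star_eq
  have sG := (reducedResolvent_isSelfAdjoint A).star_eq
  have sD : star (B - A) = B - A :=
    ((show IsSelfAdjoint B from hB).sub (show IsSelfAdjoint A from hA)).star_eq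
  have pA := groundProj_mul_self A
  have pB := groundProj_mul_self B
  set P := groundProj A
  set R := groundProj B
  set G := reducedResolvent A
  set Δ := B - A
  set Y := (1 - P) * R with hY
  set Z := (1 - R) * P with hZ
  -- the off-diagonal block, up to second order
  have hoff : ‖Y + G * Δ * P‖ ≤ 6 * γ⁻¹ ^ 2 * ‖Δ‖ ^ 2 := by
    have e : Y + G * Δ * P = (groundEnergy B - groundEnergy A) • (G * Y) -
        G * Δ * (R - P) := by
      nth_rw 1 [hid]
      noncomm_ring
    rw [e]
    refine (norm_sub_le _ _).trans ?_
    have a1 : ‖(groundEnergy B - groundEnergy A) • (G * Y)‖ ≤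
        ‖Δ‖ * (γ⁻¹ * (2 * γ⁻¹ * ‖Δ‖)) := by
      rw [norm_smul]
      refine mul_le_mul hE ((norm_mul_le _ _).trans ?_) (norm_nonneg _) (norm_nonneg _)
      exact mul_le_mul hG h1 (norm_nonneg _) hγ'.le
    have a2 : ‖G * Δ * (R - P)‖ ≤ (γ⁻¹ * ‖Δ‖) * (4 * γ⁻¹ * ‖Δ‖) := by
      refine (norm_mul_le _ _).trans (mul_le_mul ((norm_mul_le _ _).trans ?_)
        hD (norm_nonneg _) (by positivity))
      gcongr
    linarith
  -- block decomposition of the increment; the diagonal blocks are quadratic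
  have hdec : R - P + (G * Δ * P + P * Δ * G) =
      (Y + G * Δ * P) + star (Y + G * Δ * P) - (Y * star Y + star Z * Z) := by
    have e1 : star Y = R * (1 - P) := by rw [hY, star_mul, star_sub, star_one, sA, sB]
    have e2 : star Z = P * (1 - R) := by rw [hZ, star_mul, star_sub, star_one, sA, sB]
    have e3 : star (G * Δ * P) = P * Δ * G := by rw [star_mul, star_mul, sA, sD, sG, mul_assoc]
    have e4 : Y * star Y = (1 - P) * R * (1 - P) := by
      rw [e1, hY, mul_assoc, ← mul_assoc R R, pB, ← mul_assoc]
    have e5 : star Z * Z = P * (1 - R) * P := by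
      have : (1 - R) * (1 - R) = 1 - R := by
        rw [mul_sub, mul_one, sub_mul, one_mul, pB, sub_self, sub_zero]
      rw [e2, hZ, mul_assoc, ← mul_assoc (1 - R) (1 - R), this, ← mul_assoc]
    rw [star_add, e4, e5, e1, e3, hY]
    have e6 : P * (1 - R) * P = P - P * R * P := by rw [mul_sub, sub_mul, mul_one, pA]
    rw [e6]
    noncomm_ring
  rw [hdec]
  refine (norm_sub_le _ _).trans ?_
  have b1 : ‖(Y + G * Δ * P) + star (Y + G * Δ * P)‖ ≤ 12 * γ⁻¹ ^ 2 * ‖Δ‖ ^ 2 := by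
    refine (norm_add_le _ _).trans ?_
    rw [norm_star]
    linarith
  have b2 : ‖Y * star Y + star Z * Z‖ ≤ 8 * γ⁻¹ ^ 2 * ‖Δ‖ ^ 2 := by
    refine (norm_add_le _ _).trans ?_
    have c1 : ‖Y * star Y‖ ≤ (2 * γ⁻¹ * ‖Δ‖) * (2 * γ⁻¹ * ‖Δ‖) := by
      refine (norm_mul_le _ _).trans ?_
      rw [norm_star]
      exact mul_le_mul h1 h1 (norm_nonneg _) (by positivity)
    have c2 : ‖star Z * Z‖ ≤ (2 * γ⁻¹ * ‖Δ‖) * (2 * γ⁻¹ * ‖Δ‖) := by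
      refine (norm_mul_le _ _).trans ?_
      rw [norm_star]
      exact mul_le_mul h2 h2 (norm_nonneg _) (by positivity)
    linarith
  linarith

/-- Adding the projection to `A - E` removes its kernel, which expresses the reduced resolvent
through the inverse of an invertible operator. -/
theorem ringInverse_eq (hA : A.IsHermitian) :
    Ring.inverse (A - groundEnergy A • 1 + groundProj A) =
      reducedResolvent A + groundProj A := by
  have h1 : (A - groundEnergy A • 1) * groundProj A = 0 := by
    rw [sub_mul, smul_mul_assoc, one_mul, mul_groundProj hA, sub_self]
  have h2 : groundProj A * (A - groundEnergy A • 1) = 0 := by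
    rw [mul_sub, mul_smul_comm, mul_one, groundProj_mul hA, sub_self]
  have h3 : (A - groundEnergy A • 1 + groundProj A) * (reducedResolvent A + groundProj A) = 1 := by
    rw [add_mul, mul_add, mul_add, sub_mul_reducedResolvent hA, h1,
      groundProj_mul_reducedResolvent, groundProj_mul_self]
    abel
  have h4 : (reducedResolvent A + groundProj A) * (A - groundEnergy A • 1 + groundProj A) = 1 := by
    rw [add_mul, mul_add, mul_add, reducedResolvent_mul_sub hA, h2,
      reducedResolvent_mul_groundProj, groundProj_mul_self]
    abel
  exact Ring.inverse_unit ⟨_, _, h3, h4⟩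

theorem isUnit_sub_add_groundProj (hA : A.IsHermitian) :
    IsUnit (A - groundEnergy A • 1 + groundProj A) := by
  by_contra h
  have h1 := ringInverse_eq hA
  rw [Ring.inverse_non_unit _ h] at h1
  have h2 := congrArg (fun X => X * groundProj A) h1
  simp only [zero_mul, add_mul, reducedResolvent_mul_groundProj, groundProj_mul_self,
    zero_add] at h2
  have h3 : reducedResolvent A = 0 := by rw [← h2, add_zero] at h1; exact h1.symm
  have h4 := reducedResolvent_mul_sub hA
  rw [h3, ← h2, zero_mul, sub_zero] at h4
  exact zero_ne_one h4

end Perturbation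

section Regularity

variable {n : ℕ} {γ : ℝ} {E : Type*} [NormedAddCommGroup E] [NormedSpace ℝ E] {s : Set E}
  {H : E → QubitOp n}

theorem continuousOn_groundProj {X : Type*} [TopologicalSpace X] {s : Set X} {H : X → QubitOp n}
    (hγ : 0 < γ) (hH : ContinuousOn H s)
    (hherm : ∀ x ∈ s, (H x).IsHermitian) (hgap : ∀ x ∈ s, HasSpectralGap (H x) γ) :
    ContinuousOn (fun x => groundProj (H x)) s := by
  intro x hx
  have h : Tendsto (fun y => 4 * γ⁻¹ * ‖H y - H x‖) (𝓝[s] x) (𝓝 0) := by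
    have := ((tendsto_iff_norm_sub_tendsto_zero.1 (hH x hx)).const_mul (4 * γ⁻¹))
    simpa using this
  refine tendsto_iff_norm_sub_tendsto_zero.2 (squeeze_zero' (.of_forall fun _ => norm_nonneg _)
    ?_ h)
  filter_upwards [self_mem_nhdsWithin] with y hy
  exact norm_groundProj_sub_le hγ (hherm x hx) (hherm y hy) (hgap x hx) (hgap y hy)

/-- The derivative of the ground space projection along the derivative `H'` of the Hamiltonian,
as a linear map in the direction. -/
noncomputable def groundProjDeriv (A : QubitOp n) (H' : E →L[ℝ] QubitOp n) : E →L[ℝ] QubitOp n :=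
  -((ContinuousLinearMap.mulLeftRight ℝ (QubitOp n) (reducedResolvent A) (groundProj A)).comp H' +
    (ContinuousLinearMap.mulLeftRight ℝ (QubitOp n) (groundProj A) (reducedResolvent A)).comp H')

theorem groundProjDeriv_apply (A : QubitOp n) (H' : E →L[ℝ] QubitOp n) (v : E) :
    groundProjDeriv A H' v = -(reducedResolvent A * H' v * groundProj A +
      groundProj A * H' v * reducedResolvent A) := by
  simp [groundProjDeriv, ContinuousLinearMap.mulLeftRight_apply]

theorem hasFDerivWithinAt_groundProj (hγ : 0 < γ)
    (hherm : ∀ x ∈ s, (H x).IsHermitian) (hgap : ∀ x ∈ s, HasSpectralGap (H x) γ) {x : E}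
    (hx : x ∈ s) {H' : E →L[ℝ] QubitOp n} (hH : HasFDerivWithinAt H H' s x) :
    HasFDerivWithinAt (fun x => groundProj (H x)) (groundProjDeriv (H x) H') s x := by
  have hO : (fun y => H y - H x) =O[𝓝[s] x] fun y => y - x := hH.isBigO_sub
  have hsq : (fun y => ‖H y - H x‖ ^ 2) =o[𝓝[s] x] fun y => y - x := by
    have hc : (fun y => ‖H y - H x‖) =o[𝓝[s] x] fun _ => (1 : ℝ) := by
      rw [isLittleO_one_iff]
      exact tendsto_iff_norm_sub_tendsto_zero.1 hH.continuousWithinAt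
    have := hc.mul_isBigO hO.norm_norm
    simp only [one_mul, ← pow_two] at this
    exact this.of_norm_right
  have h1 : (fun y => groundProj (H y) - groundProj (H x) +
      (reducedResolvent (H x) * (H y - H x) * groundProj (H x) +
        groundProj (H x) * (H y - H x) * reducedResolvent (H x))) =o[𝓝[s] x] fun y => y - x := by
    refine IsBigO.trans_isLittleO (IsBigO.of_bound (20 * γ⁻¹ ^ 2) ?_) hsq
    filter_upwards [self_mem_nhdsWithin] with y hy
    rw [Real.norm_of_nonneg (by positivity)]
    exact norm_groundProj_sub_add_le hγ (hherm x hx) (hherm y hy) (hgap x hx) (hgap y hy)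
  -- replacing the increment of `H` by its linear part costs another term of lower order
  have h2 : (fun y => groundProjDeriv (H x) (ContinuousLinearMap.id ℝ (QubitOp n))
      (H y - H x - H' (y - x))) =o[𝓝[s] x] fun y => y - x :=
    (ContinuousLinearMap.isBigO_comp _ _ _).trans_isLittleO hH.isLittleO
  refine .of_isLittleO ((h1.add h2).congr_left fun y => ?_)
  simp only [groundProjDeriv_apply, ContinuousLinearMap.id_apply]
  noncomm_ring

theorem groundEnergy_eq_mul {A : QubitOp n} (hA : A.IsHermitian) (h : HasSpectralGap A γ) :
    groundEnergy A = ((A * groundProj A).trace * (groundProj A).trace⁻¹).re := by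
  rw [mul_groundProj hA, Matrix.trace_smul, Complex.real_smul,
    mul_inv_cancel_right₀ (trace_groundProj_ne_zero hA h), Complex.ofReal_re]

theorem contDiffOn_matrix_trace {f : E → QubitOp n} {j : WithTop ℕ∞} (hf : ContDiffOn ℝ j f s) :
    ContDiffOn ℝ j (fun x => (f x).trace) s :=
  (LinearMap.toContinuousLinearMap (Matrix.traceLinearMap (Fin n → Fin 2) ℝ ℂ)).contDiff.comp_contDiffOn
    hf

theorem contDiffOn_reducedResolvent {j : WithTop ℕ∞} (hH : ContDiffOn ℝ j H s)
    (hherm : ∀ x ∈ s, (H x).IsHermitian) (hgap : ∀ x ∈ s, HasSpectralGap (H x) γ)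
    (hP : ContDiffOn ℝ j (fun x => groundProj (H x)) s) :
    ContDiffOn ℝ j (fun x => reducedResolvent (H x)) s := by
  have hE : ContDiffOn ℝ j (fun x => groundEnergy (H x)) s := by
    have h1 : ContDiffOn ℝ j (fun x =>
        (H x * groundProj (H x)).trace * (groundProj (H x)).trace⁻¹) s :=
      (contDiffOn_matrix_trace (hH.mul hP)).mul ((contDiffOn_matrix_trace hP).inv fun x hx =>
        trace_groundProj_ne_zero (hherm x hx) (hgap x hx))
    exact (Complex.reCLM.contDiff.comp_contDiffOn h1).congr fun x hx =>
      groundEnergy_eq_mul (hherm x hx) (hgap x hx)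
  have h2 : ContDiffOn ℝ j (fun x => H x - groundEnergy (H x) • 1 + groundProj (H x)) s :=
    (hH.sub (hE.smul contDiffOn_const)).add hP
  have h3 : ContDiffOn ℝ j (fun x =>
      Ring.inverse (H x - groundEnergy (H x) • 1 + groundProj (H x)) - groundProj (H x)) s := by
    refine ContDiffOn.sub (fun x hx => ?_) hP
    obtain ⟨u, hu⟩ := isUnit_sub_add_groundProj (hherm x hx)
    have := contDiffAt_ringInverse ℝ u (n := j)
    rw [hu] at this
    exact this.comp_contDiffWithinAt x (h2 x hx)
  exact h3.congr fun x hx => by rw [ringInverse_eq (hherm x hx), add_sub_cancel_right]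

/-- The ground space projection is as smooth as the Hamiltonian: its derivative is a smooth
expression in `H`, `H'` and the projection itself, so smoothness bootstraps. -/
theorem contDiffOn_groundProj (hγ : 0 < γ) (hs : UniqueDiffOn ℝ s) {k : ℕ}
    (hH : ContDiffOn ℝ k H s)
    (hherm : ∀ x ∈ s, (H x).IsHermitian) (hgap : ∀ x ∈ s, HasSpectralGap (H x) γ) :
    ContDiffOn ℝ k (fun x => groundProj (H x)) s := by
  induction k with
  | zero =>
    exact contDiffOn_zero.2 (continuousOn_groundProj hγ hH.continuousOn hherm hgap)
  | succ k ih =>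
    have hHk : ContDiffOn ℝ k H s := hH.of_le (by norm_cast; omega)
    have hPk := ih hHk
    have hGk := contDiffOn_reducedResolvent hHk hherm hgap hPk
    have hH' : ContDiffOn ℝ k (fderivWithin ℝ H s) s := hH.fderivWithin hs (by norm_cast)
    have hd : ∀ x ∈ s, HasFDerivWithinAt (fun x => groundProj (H x))
        (groundProjDeriv (H x) (fderivWithin ℝ H s x)) s x := fun x hx =>
      hasFDerivWithinAt_groundProj hγ hherm hgap hx
        (hH.differentiableOn (by simp) x hx).hasFDerivWithinAt
    push_cast
    rw [contDiffOn_succ_iff_fderivWithin hs]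
    refine ⟨fun x hx => (hd x hx).differentiableWithinAt, fun h => by simp at h, ?_⟩
    have hL : ContDiff ℝ k (fun X => ContinuousLinearMap.mulLeftRight ℝ (QubitOp n) X) :=
      ContinuousLinearMap.contDiff _
    have : ContDiffOn ℝ k (fun x => groundProjDeriv (H x) (fderivWithin ℝ H s x)) s :=
      (((((hL.comp_contDiffOn hGk).clm_apply hPk).clm_comp hH').add
        (((hL.comp_contDiffOn hPk).clm_apply hGk).clm_comp hH'))).neg
    exact this.congr fun x hx => (hd x hx).fderivWithin (hs x hx)

/-- The dimension of the ground space is constant on a convex parameter set: the derivative of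
the projection is block off-diagonal, hence traceless. -/
theorem trace_groundProj_eq (hγ : 0 < γ) (hs : UniqueDiffOn ℝ s) (hconv : Convex ℝ s)
    (hH : DifferentiableOn ℝ H s)
    (hherm : ∀ x ∈ s, (H x).IsHermitian) (hgap : ∀ x ∈ s, HasSpectralGap (H x) γ) {x y : E}
    (hx : x ∈ s) (hy : y ∈ s) : (groundProj (H x)).trace = (groundProj (H y)).trace := by
  have hd : ∀ x ∈ s, HasFDerivWithinAt (fun x => (groundProj (H x)).trace) (0 : E →L[ℝ] ℂ) s x := by
    intro x hx
    have h1 := hasFDerivWithinAt_groundProj hγ hherm hgap hx (hH x hx).hasFDerivWithinAt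
    have h2 := (LinearMap.toContinuousLinearMap
      (Matrix.traceLinearMap (Fin n → Fin 2) ℝ ℂ)).hasFDerivAt.comp_hasFDerivWithinAt x h1
    refine h2.congr_fderiv ?_
    ext v
    change (groundProjDeriv (H x) (fderivWithin ℝ H s x) v).trace = 0
    rw [groundProjDeriv_apply, Matrix.trace_neg, Matrix.trace_add, mul_assoc,
      Matrix.trace_mul_comm, mul_assoc, groundProj_mul_reducedResolvent, mul_assoc,
      Matrix.trace_mul_comm (groundProj (H x)), mul_assoc, reducedResolvent_mul_groundProj]
    simp
  exact hconv.is_const_of_fderivWithin_eq_zero (𝕜 := ℝ)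
    (fun x hx => (hd x hx).differentiableWithinAt)
    (fun x hx => (hd x hx).fderivWithin (hs x hx)) hx hy

end Regularity

/-! ### Weighted trace norms -/

section IdealNorm

variable {n : ℕ} {γ : ℝ}

/-- A subadditive function on operators that dominates the spectral norm and is compatible with
multiplication by bounded operators on either side. -/
structure IsIdealNorm (N : QubitOp n → ℝ) : Prop where
  add_le : ∀ X Y, N (X + Y) ≤ N X + N Y
  neg_eq : ∀ X, N (-X) = N X
  mul_left_le : ∀ W X, N (W * X) ≤ ‖W‖ * N X
  mul_right_le : ∀ X W, N (X * W) ≤ N X * ‖W‖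
  norm_le : ∀ X, ‖X‖ ≤ N X

namespace IsIdealNorm

variable {N : QubitOp n → ℝ}

theorem nonneg (hN : IsIdealNorm N) (X : QubitOp n) : 0 ≤ N X :=
  (norm_nonneg X).trans (hN.norm_le X)

theorem map_zero (hN : IsIdealNorm N) : N 0 = 0 :=
  le_antisymm (by simpa using hN.mul_left_le 0 0) (hN.nonneg 0)

theorem sub_le (hN : IsIdealNorm N) (X Y : QubitOp n) : N (X - Y) ≤ N X + N Y := by
  rw [sub_eq_add_neg, ← hN.neg_eq Y]
  exact hN.add_le _ _

theorem mul_mul_le (hN : IsIdealNorm N) (V X W : QubitOp n) {a b : ℝ} (hV : ‖V‖ ≤ a)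
    (hW : ‖W‖ ≤ b) : N (V * X * W) ≤ a * b * N X := by
  have ha := (norm_nonneg V).trans hV
  calc N (V * X * W) ≤ N (V * X) * ‖W‖ := hN.mul_right_le _ _
    _ ≤ (‖V‖ * N X) * ‖W‖ := by gcongr; exact hN.mul_left_le _ _
    _ ≤ (a * N X) * b := mul_le_mul (mul_le_mul_of_nonneg_right hV (hN.nonneg X)) hW
        (norm_nonneg _) (mul_nonneg ha (hN.nonneg X))
    _ = a * b * N X := by ring

end IsIdealNorm

/-- The linear functional `W ↦ tr (W X)`. Its norm is the trace norm of `X`. -/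
noncomputable def traceDual (X : QubitOp n) : QubitOp n →L[ℂ] ℂ :=
  LinearMap.toContinuousLinearMap
    ((Matrix.traceLinearMap (Fin n → Fin 2) ℂ ℂ).comp (LinearMap.mulRight ℂ X))

theorem traceDual_apply (X W : QubitOp n) : traceDual X W = (W * X).trace := rfl

/-- The maximum of the spectral norm and the trace norm divided by `r`. -/
noncomputable def weightedTraceNorm (r : ℝ) (X : QubitOp n) : ℝ := max ‖X‖ (‖traceDual X‖ / r)

theorem isIdealNorm_weightedTraceNorm {r : ℝ} (hr : 0 < r) :
    IsIdealNorm (weightedTraceNorm r : QubitOp n → ℝ) where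
  add_le X Y := by
    have h : traceDual (X + Y) = traceDual X + traceDual Y := by
      ext W; simp [traceDual_apply, mul_add]
    refine max_le ((norm_add_le _ _).trans (add_le_add (le_max_left _ _) (le_max_left _ _))) ?_
    calc ‖traceDual (X + Y)‖ / r ≤ ‖traceDual X‖ / r + ‖traceDual Y‖ / r := by
          rw [h, ← add_div]; gcongr; exact norm_add_le _ _
      _ ≤ _ := add_le_add (le_max_right _ _) (le_max_right _ _)
  neg_eq X := by
    have h : traceDual (-X) = -traceDual X := by
      ext W; simp [traceDual_apply]
    rw [weightedTraceNorm, h, norm_neg, norm_neg, weightedTraceNorm]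
  mul_left_le W X := by
    have h : ‖traceDual (W * X)‖ ≤ ‖W‖ * ‖traceDual X‖ := by
      refine ContinuousLinearMap.opNorm_le_bound _ (by positivity) fun V => ?_
      rw [traceDual_apply, ← mul_assoc, ← traceDual_apply]
      calc _ ≤ ‖traceDual X‖ * ‖V * W‖ := (traceDual X).le_opNorm _
        _ ≤ ‖traceDual X‖ * (‖V‖ * ‖W‖) := by gcongr; exact norm_mul_le _ _
        _ = _ := by ring
    refine max_le ((norm_mul_le _ _).trans ?_) ?_
    · gcongr; exact le_max_left _ _
    · calc _ ≤ ‖W‖ * ‖traceDual X‖ / r := by gcongr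
        _ = ‖W‖ * (‖traceDual X‖ / r) := mul_div_assoc _ _ _
        _ ≤ _ := by gcongr; exact le_max_right _ _
  mul_right_le X W := by
    have h : ‖traceDual (X * W)‖ ≤ ‖traceDual X‖ * ‖W‖ := by
      refine ContinuousLinearMap.opNorm_le_bound _ (by positivity) fun V => ?_
      rw [traceDual_apply, ← mul_assoc, Matrix.trace_mul_comm, ← mul_assoc, ← traceDual_apply]
      calc _ ≤ ‖traceDual X‖ * ‖W * V‖ := (traceDual X).le_opNorm _
        _ ≤ ‖traceDual X‖ * (‖W‖ * ‖V‖) := by gcongr; exact norm_mul_le _ _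
        _ = _ := by ring
    refine max_le ((norm_mul_le _ _).trans ?_) ?_
    · gcongr; exact le_max_left _ _
    · calc _ ≤ ‖traceDual X‖ * ‖W‖ / r := by gcongr
        _ = (‖traceDual X‖ / r) * ‖W‖ := by ring
        _ ≤ _ := by gcongr; exact le_max_right _ _
  norm_le X := le_max_left _ _

theorem norm_trace_mul_le_weightedTraceNorm {r : ℝ} (hr : 0 < r) (W X : QubitOp n) :
    ‖(W * X).trace‖ ≤ ‖W‖ * (r * weightedTraceNorm r X) := by
  have h : ‖traceDual X‖ ≤ r * weightedTraceNorm r X := by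
    rw [← div_le_iff₀' hr]
    exact le_max_right _ _
  calc ‖(W * X).trace‖ ≤ ‖traceDual X‖ * ‖W‖ := (traceDual X).le_opNorm W
    _ ≤ (r * weightedTraceNorm r X) * ‖W‖ := by gcongr
    _ = _ := mul_comm _ _

theorem weightedTraceNorm_groundProj_le (A : QubitOp n) (h : (groundProj A).trace ≠ 0) :
    weightedTraceNorm ‖(groundProj A).trace‖ (groundProj A) ≤ 1 := by
  refine max_le (norm_groundProj_le A) ?_
  rw [div_le_one (norm_pos_iff.2 h)]
  refine ContinuousLinearMap.opNorm_le_bound _ (norm_nonneg _) fun W => ?_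
  rw [traceDual_apply, mul_comm]
  exact norm_trace_mul_groundProj_le A W

/-! ### The recursive estimate for the derivatives of the projection -/

/-- The solution of the linearised equations for a ground space projection. The block diagonal
part of `X` is determined by the first equation (differentiating `Π² = Π`), the off-diagonal
part by the second one (differentiating `A Π = Π A`). -/
theorem eq_of_linearised {A : QubitOp n} (hA : A.IsHermitian) {X S T : QubitOp n}
    (hS : X = groundProj A * X + (X * groundProj A + S)) (hT : A * X - X * A + T = 0) :
    X = ((1 - groundProj A) * S * (1 - groundProj A) - groundProj A * S * groundProj A) +
      (groundProj A * T * reducedResolvent A - reducedResolvent A * T * groundProj A) := by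
  have pp := groundProj_mul_self A
  have hG1 := reducedResolvent_mul_sub hA
  have hG2 := sub_mul_reducedResolvent hA
  have hAP := mul_groundProj hA
  have hPA := groundProj_mul hA
  set P := groundProj A
  set G := reducedResolvent A
  set ε := groundEnergy A
  have hT' : T = X * A - A * X := by rw [← sub_eq_zero, ← hT]; abel
  have hS' : S = X - P * X - X * P := by
    rw [sub_sub, eq_sub_iff_add_eq]
    conv_rhs => rw [hS]
    abel
  have e1 : G * T * P = -((1 - P) * X * P) := by
    have : T * P = -((A - ε • 1) * X * P) := by
      rw [hT', sub_mul, mul_assoc X A P, hAP, mul_smul_comm, sub_mul, sub_mul, smul_mul_assoc,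
        one_mul, smul_mul_assoc]
      abel
    rw [mul_assoc, this, mul_neg, ← mul_assoc, ← mul_assoc, hG1]
  have e2 : P * T * G = P * X * (1 - P) := by
    have : P * T = P * X * (A - ε • 1) := by
      rw [hT', mul_sub, ← mul_assoc P A X, hPA, smul_mul_assoc, mul_sub, mul_smul_comm, mul_one,
        mul_assoc]
    rw [this, mul_assoc, hG2]
  have e3 : P * S * P = -(P * X * P) := by
    have : P * S * P = P * X * P - (P * P) * X * P - P * X * (P * P) := by
      rw [hS']; noncomm_ring
    rw [this, pp]; abel
  have e4 : (1 - P) * S * (1 - P) = (1 - P) * X * (1 - P) := by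
    have : (1 - P) * S * (1 - P) = (1 - P) * X * (1 - P) - (P - P * P) * X * (1 - P) -
        (1 - P) * X * (P - P * P) := by
      rw [hS']; noncomm_ring
    rw [this, pp]; simp
  rw [e1, e2, e3, e4]
  noncomm_ring

theorem IsIdealNorm.le_of_linearised {N : QubitOp n → ℝ} (hN : IsIdealNorm N) {A : QubitOp n}
    (hγ : 0 < γ) (hA : A.IsHermitian) (hgap : HasSpectralGap A γ) {X S T : QubitOp n}
    (hS : X = groundProj A * X + (X * groundProj A + S)) (hT : A * X - X * A + T = 0) :
    N X ≤ 2 * N S + 2 * γ⁻¹ * N T := by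
  have hP := norm_groundProj_le A
  have hQ := norm_one_sub_groundProj_le hA
  have hG := norm_reducedResolvent_le hγ hgap
  rw [eq_of_linearised hA hS hT]
  refine (hN.add_le _ _).trans ?_
  have h1 := hN.sub_le ((1 - groundProj A) * S * (1 - groundProj A))
    (groundProj A * S * groundProj A)
  have h2 := hN.sub_le (groundProj A * T * reducedResolvent A)
    (reducedResolvent A * T * groundProj A)
  have h3 := hN.mul_mul_le _ S _ hQ hQ
  have h4 := hN.mul_mul_le _ S _ hP hP
  have h5 := hN.mul_mul_le _ T _ hP hG
  have h6 := hN.mul_mul_le _ T _ hG hP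
  linarith

/-- The growth estimate for a family `p` obeying the differentiated equations `Π² = Π` and
`A Π = Π A` along all sublists of a list of directions. The base `M` absorbs the number of
terms in the recursion, and the spare factor `M⁻¹` closes the quadratic induction. -/
theorem IsIdealNorm.family_le {V : Type*} {N : QubitOp n → ℝ} (hN : IsIdealNorm N)
    (hγ : 0 < γ) {p h : List V → QubitOp n} (hA : (h []).IsHermitian)
    (hgap : HasSpectralGap (h []) γ) (hp : p [] = groundProj (h []))
    (hN1 : N (p []) ≤ 1) {K : ℕ} {M : ℝ} (hM : (2 + 4 * γ⁻¹) * (K + 1) ≤ M) (L : List V)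
    (hL : L.length ≤ K)
    (hsq : ∀ L', L'.Sublist L → p L' = splitSum L' fun B C => p B * p C)
    (hcomm : ∀ L', L'.Sublist L →
      (splitSum L' fun B C => h B * p C) = splitSum L' fun B C => p B * h C)
    (hh : ∀ L', L'.Sublist L → L' ≠ [] → ‖h L'‖ ≤ 1) (hne : L ≠ []) :
    N (p L) ≤ L.length.factorial * M ^ (2 * L.length) * M⁻¹ := by
  have hγ' : 0 < γ⁻¹ := inv_pos.2 hγ
  have hM1 : 1 ≤ M := by
    refine le_trans ?_ hM
    have : (0 : ℝ) ≤ K := K.cast_nonneg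
    nlinarith
  have hM0 : 0 < M := by linarith
  induction hl : L.length using Nat.strong_induction_on generalizing L with
  | _ l ih =>
  subst hl
  have hstrict : ∀ B, B.Sublist L → B.length < L.length → B ≠ [] →
      N (p B) ≤ B.length.factorial * M ^ (2 * B.length) * M⁻¹ := fun B hB hlt hB0 =>
    ih B.length hlt B (hB.length_le.trans hL) (fun L' h' => hsq L' (h'.trans hB))
      (fun L' h' => hcomm L' (h'.trans hB)) (fun L' h' => hh L' (h'.trans hB)) hB0 rfl
  have hweak : ∀ B, B.Sublist L → B.length < L.length →
      N (p B) ≤ B.length.factorial * M ^ (2 * B.length) := by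
    intro B hB hlt
    by_cases hB0 : B = []
    · subst hB0; simpa using hN1
    · refine (hstrict B hB hlt hB0).trans (mul_le_of_le_one_right (by positivity) ?_)
      exact inv_le_one_of_one_le₀ hM1
  set D : ℝ := M ^ (2 * L.length) * M⁻¹ ^ 2 with hD
  have hD0 : 0 ≤ D := by positivity
  -- the terms of `T` are linear in `p`; as `B` is nonempty, `C` has at least one direction fewer
  -- than `L`, which yields the factor `M⁻¹ ^ 2`
  have hlow : ∀ B C : List V, B ≠ [] → B.length + C.length = L.length →
      (C.length.factorial : ℝ) * M ^ (2 * C.length) ≤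
        D * (B.length.factorial * C.length.factorial) := by
    intro B C hB hlen
    have hB1 : 1 ≤ B.length := List.length_pos_iff.2 hB
    have h1 : M ^ (2 * C.length) ≤ D := by
      rw [hD, inv_pow, ← div_eq_mul_inv, le_div_iff₀ (by positivity), ← pow_add]
      exact pow_le_pow_right₀ hM1 (by omega)
    have h2 : (1 : ℝ) ≤ B.length.factorial := by exact_mod_cast B.length.factorial_pos
    calc _ ≤ (C.length.factorial : ℝ) * D := by gcongr
      _ ≤ (C.length.factorial : ℝ) * D * B.length.factorial :=
        le_mul_of_one_le_right (by positivity) h2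
      _ = _ := by ring
  have hsum : splitSum L (fun B C => D * ((B.length.factorial : ℝ) * C.length.factorial)) =
      D * ((L.length + 1) * L.length.factorial) := by
    rw [← splitSum_factorial]
    exact (map_splitSum (AddMonoidHom.mulLeft D) L _).symm
  -- `p L` occurs in the two equations only in the terms with an empty part
  set S := splitSum L fun B C => if B = [] ∨ C = [] then 0 else p B * p C with hSdef
  set T₁ := splitSum L fun B C => if B = [] then 0 else h B * p C with hT₁def
  set T₂ := splitSum L fun B C => if C = [] then 0 else p B * h C with hT₂def
  have hS : p L = groundProj (h []) * p L + (p L * groundProj (h []) + S) := by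
    conv_lhs => rw [hsq L (List.Sublist.refl _), splitSum_eq_left_add_right_add hne, hp]
  have hT : h [] * p L - p L * h [] + (T₁ - T₂) = 0 := by
    have h1 := hcomm L (List.Sublist.refl _)
    rw [splitSum_eq_left_add, splitSum_eq_right_add L fun B C => p B * h C] at h1
    rw [← sub_eq_zero] at h1
    rw [← h1]
    abel
  have hNS : N S ≤ D * ((L.length + 1) * L.length.factorial) := by
    rw [← hsum]
    refine (apply_splitSum_le N hN.add_le _ _).trans (splitSum_mono L fun B C hB hC hlen => ?_)
    split_ifs with h0
    · rw [hN.map_zero]; positivity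
    · push Not at h0
      have hB1 : 1 ≤ B.length := List.length_pos_iff.2 h0.1
      have hC1 : 1 ≤ C.length := List.length_pos_iff.2 h0.2
      calc N (p B * p C) ≤ N (p B) * N (p C) :=
            (hN.mul_right_le _ _).trans (mul_le_mul_of_nonneg_left (hN.norm_le _) (hN.nonneg _))
        _ ≤ (B.length.factorial * M ^ (2 * B.length) * M⁻¹) *
            (C.length.factorial * M ^ (2 * C.length) * M⁻¹) :=
          mul_le_mul (hstrict B hB (by omega) h0.1) (hstrict C hC (by omega) h0.2)
            (hN.nonneg _) (by positivity)
        _ = _ := by rw [hD, ← hlen]; ring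
  have hNT₁ : N T₁ ≤ D * ((L.length + 1) * L.length.factorial) := by
    rw [← hsum]
    refine (apply_splitSum_le N hN.add_le _ _).trans (splitSum_mono L fun B C hB hC hlen => ?_)
    split_ifs with h0
    · rw [hN.map_zero]; positivity
    · have hB1 : 1 ≤ B.length := List.length_pos_iff.2 h0
      refine (hN.mul_left_le _ _).trans ((mul_le_of_le_one_left (hN.nonneg _)
        (hh B hB h0)).trans ?_)
      exact (hweak C hC (by omega)).trans (hlow B C h0 hlen)
  have hNT₂ : N T₂ ≤ D * ((L.length + 1) * L.length.factorial) := by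
    rw [← hsum]
    refine (apply_splitSum_le N hN.add_le _ _).trans (splitSum_mono L fun B C hB hC hlen => ?_)
    split_ifs with h0
    · rw [hN.map_zero]; positivity
    · have hC1 : 1 ≤ C.length := List.length_pos_iff.2 h0
      refine (hN.mul_right_le _ _).trans ((mul_le_of_le_one_right (hN.nonneg _)
        (hh C hC h0)).trans ?_)
      rw [mul_comm (B.length.factorial : ℝ)]
      exact (hweak B hB (by omega)).trans (hlow C B h0 (by omega))
  have hX := hN.le_of_linearised hγ hA hgap hS hT
  have hNT := hN.sub_le T₁ T₂
  have hl1 : (2 + 4 * γ⁻¹) * (L.length + 1) ≤ M := by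
    refine le_trans ?_ hM
    have : (L.length : ℝ) ≤ K := by exact_mod_cast hL
    gcongr
  calc N (p L) ≤ 2 * N S + 2 * γ⁻¹ * N (T₁ - T₂) := hX
    _ ≤ 2 * (D * ((L.length + 1) * L.length.factorial)) +
        2 * γ⁻¹ * (2 * (D * ((L.length + 1) * L.length.factorial))) := by
      gcongr
      linarith
    _ = ((2 + 4 * γ⁻¹) * (L.length + 1)) * (L.length.factorial * D) := by ring
    _ ≤ M * (L.length.factorial * D) := by gcongr
    _ = L.length.factorial * M ^ (2 * L.length) * M⁻¹ := by
      rw [hD]; field_simp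

end IdealNorm

/-! ### Derivatives of ground state properties -/

section GroundProperty

variable {n m k : ℕ} {γ : ℝ} {H : (Fin m → ℝ) → QubitOp n}

theorem uniqueDiffOn_cube (m : ℕ) : UniqueDiffOn ℝ (cube m) := by
  rw [cube, ← Set.pi_univ_Icc]
  exact UniqueDiffOn.univ_pi fun _ => uniqueDiffOn_Icc (by norm_num)

theorem convex_cube (m : ℕ) : Convex ℝ (cube m) := convex_Icc _ _

theorem groundProperty_eq (hγ : 0 < γ) (P : Fin n → Pauli) (α : ℝ) {x : Fin m → ℝ}
    (hA : (H x).IsHermitian) (hgap : HasSpectralGap (H x) γ) :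
    groundProperty H P α x =
      α * ((groundProj (H x)).trace⁻¹ * (pauliString P * groundProj (H x)).trace) := by
  rw [groundProperty, groundState_eq hγ hA hgap, mul_smul_comm, Matrix.trace_smul, smul_eq_mul]

theorem contDiffOn_groundProperty (hγ : 0 < γ) (P : Fin n → Pauli) (α : ℝ)
    (hH : ContDiffOn ℝ k H (cube m)) (hherm : ∀ x ∈ cube m, (H x).IsHermitian)
    (hgap : ∀ x ∈ cube m, HasSpectralGap (H x) γ) :
    ContDiffOn ℝ k (groundProperty H P α) (cube m) := by
  have hP := contDiffOn_groundProj hγ (uniqueDiffOn_cube m) hH hherm hgap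
  have h1 : ContDiffOn ℝ k (fun x => (α : ℂ) * ((groundProj (H x)).trace⁻¹ *
      (pauliString P * groundProj (H x)).trace)) (cube m) :=
    contDiffOn_const.mul (((contDiffOn_matrix_trace hP).inv fun x hx =>
      trace_groundProj_ne_zero (hherm x hx) (hgap x hx)).mul
        (contDiffOn_matrix_trace (contDiffOn_const.mul hP)))
  exact h1.congr fun x hx => groundProperty_eq hγ P α (hherm x hx) (hgap x hx)

/-- Since the ground space dimension is constant, derivatives of ground state properties reduce
to derivatives of the ground space projection. -/
theorem iterDeriv_groundProperty (hγ : 0 < γ) (P : Fin n → Pauli) (α : ℝ)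
    (hH : ContDiffOn ℝ k H (cube m)) (hherm : ∀ x ∈ cube m, (H x).IsHermitian)
    (hgap : ∀ x ∈ cube m, HasSpectralGap (H x) γ) {x : Fin m → ℝ} (hx : x ∈ cube m)
    {L : List (Fin m → ℝ)} (hL : L.length ≤ k) :
    iterDeriv (cube m) L (groundProperty H P α) x =
      α * ((groundProj (H x)).trace⁻¹ *
        (pauliString P * iterDeriv (cube m) L (fun y => groundProj (H y)) x).trace) := by
  have hs := uniqueDiffOn_cube m
  by_cases hL0 : L = []
  · subst hL0
    exact groundProperty_eq hγ P α (hherm x hx) (hgap x hx)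
  -- differentiability of `H`, and with it constancy of `tr Π`, needs at least one direction
  have hk : k ≠ 0 := by
    have := List.length_pos_iff.2 hL0
    omega
  let φ : QubitOp n →L[ℝ] ℂ := LinearMap.toContinuousLinearMap
    ((LinearMap.mulLeft ℝ ((α : ℂ) * (groundProj (H x)).trace⁻¹)).comp
      ((Matrix.traceLinearMap (Fin n → Fin 2) ℝ ℂ).comp (LinearMap.mulLeft ℝ (pauliString P))))
  have hφ : ∀ X, φ X = α * ((groundProj (H x)).trace⁻¹ * (pauliString P * X).trace) :=
    fun X => mul_assoc _ _ _
  have heq : Set.EqOn (groundProperty H P α) (fun y => φ (groundProj (H y))) (cube m) := by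
    intro y hy
    beta_reduce
    rw [groundProperty_eq hγ P α (hherm y hy) (hgap y hy), hφ,
      trace_groundProj_eq hγ hs (convex_cube m)
        (hH.differentiableOn (by exact_mod_cast hk)) hherm hgap hy hx]
  rw [iterDeriv_congr L heq hx, ← hφ]
  exact iterDeriv_clm_comp hs φ (contDiffOn_groundProj hγ hs hH hherm hgap) hL hx

/-- The recursive estimate applied with the trace norm divided by the ground space dimension,
which cancels the normalisation of the ground state. -/
theorem norm_iterDeriv_groundProperty_le (hγ : 0 < γ) (P : Fin n → Pauli) (α : ℝ)
    (hH : ContDiffOn ℝ k H (cube m)) (hherm : ∀ x ∈ cube m, (H x).IsHermitian)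
    (hgap : ∀ x ∈ cube m, HasSpectralGap (H x) γ) {x : Fin m → ℝ} (hx : x ∈ cube m)
    {L : List (Fin m → ℝ)} (hL : L.length ≤ k)
    (hbound : ∀ A, A.Sublist L → A ≠ [] → ‖iterDeriv (cube m) A H x‖ ≤ 1) :
    ‖iterDeriv (cube m) L (groundProperty H P α) x‖ ≤
      |α| * ((2 + 4 * γ⁻¹) * (k + 1)) ^ (3 * k) := by
  have hs := uniqueDiffOn_cube m
  have hP := contDiffOn_groundProj hγ hs hH hherm hgap
  have htr := trace_groundProj_ne_zero (hherm x hx) (hgap x hx)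
  set r := ‖(groundProj (H x)).trace‖ with hr
  have hr0 : 0 < r := norm_pos_iff.2 htr
  have hN := isIdealNorm_weightedTraceNorm (n := n) hr0
  have hN1 := weightedTraceNorm_groundProj_le (H x) htr
  set M : ℝ := (2 + 4 * γ⁻¹) * (k + 1) with hM
  have hγ' : 0 < γ⁻¹ := inv_pos.2 hγ
  have hkM : (k : ℝ) ≤ M := by
    have : (0 : ℝ) ≤ k := k.cast_nonneg
    rw [hM]; nlinarith
  have hM1 : 1 ≤ M := by
    have : (0 : ℝ) ≤ k := k.cast_nonneg
    rw [hM]; nlinarith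
  have hM0 : 0 < M := by linarith
  have hmain : weightedTraceNorm r (iterDeriv (cube m) L (fun y => groundProj (H y)) x) ≤
      M ^ (3 * k) := by
    by_cases hL0 : L = []
    · subst hL0
      exact hN1.trans (one_le_pow₀ hM1)
    have h1 := hN.family_le hγ
      (p := fun L => iterDeriv (cube m) L (fun y => groundProj (H y)) x)
      (h := fun L => iterDeriv (cube m) L H x) (hherm x hx) (hgap x hx) rfl hN1 hM.ge L hL
      (fun L' h' => by
        have hl := h'.length_le.trans hL
        refine Eq.trans ?_ (iterDeriv_mul hs hP hP hl hx)
        exact iterDeriv_congr L' (fun y _ => (groundProj_mul_self (H y)).symm) hx)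
      (fun L' h' => by
        have hl := h'.length_le.trans hL
        refine (iterDeriv_mul hs hH hP hl hx).symm.trans
          (Eq.trans ?_ (iterDeriv_mul hs hP hH hl hx))
        exact iterDeriv_congr L' (fun y hy => by
          rw [mul_groundProj (hherm y hy), groundProj_mul (hherm y hy)]) hx)
      hbound hL0
    have h2 : (L.length.factorial : ℝ) ≤ M ^ L.length := by
      calc (L.length.factorial : ℝ) ≤ (L.length : ℝ) ^ L.length := by
            exact_mod_cast L.length.factorial_le_pow
        _ ≤ M ^ L.length := by
          gcongr
          exact le_trans (by exact_mod_cast hL) hkM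
    calc _ ≤ L.length.factorial * M ^ (2 * L.length) * M⁻¹ := h1
      _ ≤ L.length.factorial * M ^ (2 * L.length) :=
        mul_le_of_le_one_right (by positivity) (inv_le_one_of_one_le₀ hM1)
      _ ≤ M ^ L.length * M ^ (2 * L.length) := by gcongr
      _ = M ^ (3 * L.length) := by ring
      _ ≤ M ^ (3 * k) := pow_le_pow_right₀ hM1 (by omega)
  rw [iterDeriv_groundProperty hγ P α hH hherm hgap hx hL, norm_mul, norm_mul, norm_inv,
    Complex.norm_real, Real.norm_eq_abs]
  refine mul_le_mul_of_nonneg_left ?_ (abs_nonneg α)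
  rw [inv_mul_le_iff₀ hr0]
  calc _ ≤ ‖pauliString P‖ * (r * weightedTraceNorm r _) :=
        norm_trace_mul_le_weightedTraceNorm hr0 _ _
    _ ≤ r * weightedTraceNorm r _ :=
      mul_le_of_le_one_left (mul_nonneg hr0.le (hN.nonneg _)) (norm_pauliString_le P)
    _ ≤ r * M ^ (3 * k) := by gcongr

theorem mixedPartial_eq_iterDeriv {F : Type*} [NormedAddCommGroup F] [NormedSpace ℝ F] {l : ℕ}
    {f : (Fin m → ℝ) → F} (hf : ContDiffOn ℝ k f (cube m)) (hl : l ≤ k) (i : Fin l → Fin m)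
    {x : Fin m → ℝ} (hx : x ∈ cube m) :
    mixedPartial f i x = iterDeriv (cube m) (List.ofFn fun j => Pi.single (i j) 1) f x :=
  iteratedFDerivWithin_eq_iterDeriv (uniqueDiffOn_cube m)
    (hf.of_le (by exact_mod_cast hl)) _ hx

theorem norm_mixedPartial_groundProperty_le (hγ : 0 < γ) (P : Fin n → Pauli) (α : ℝ)
    (hH : ContDiffOn ℝ k H (cube m)) (hherm : ∀ x ∈ cube m, (H x).IsHermitian)
    (hgap : ∀ x ∈ cube m, HasSpectralGap (H x) γ) {x : Fin m → ℝ} (hx : x ∈ cube m)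
    {l : ℕ} (hl : l ≤ k) (i : Fin l → Fin m)
    (hbound : ∀ j : ℕ, 1 ≤ j → ∀ σ : Fin j ↪o Fin l, ‖mixedPartial H (i ∘ σ) x‖ ≤ 1) :
    ‖mixedPartial (groundProperty H P α) i x‖ ≤
      |α| * ((2 + 4 * γ⁻¹) * (k + 1)) ^ (3 * k) := by
  rw [mixedPartial_eq_iterDeriv (contDiffOn_groundProperty hγ P α hH hherm hgap) hl i hx]
  refine norm_iterDeriv_groundProperty_le hγ P α hH hherm hgap hx (by simpa using hl)
    fun A hA hA0 => ?_
  obtain ⟨f, hf⟩ := List.sublist_iff_exists_fin_orderEmbedding_get_eq.1 hA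
  let σ : Fin A.length ↪o Fin l := f.trans (Fin.castOrderIso (List.length_ofFn)).toOrderEmbedding
  have hAσ : A = List.ofFn fun j => Pi.single ((i ∘ σ) j) (1 : ℝ) := by
    refine List.ext_get (by simp) fun j h1 h2 => ?_
    rw [hf ⟨j, h1⟩]
    simp [σ]
    rfl
  have hAl : A.length ≤ k := by
    have := hA.length_le
    simp only [List.length_ofFn] at this
    omega
  have := hbound A.length (List.length_pos_iff.2 hA0) σ
  rwa [mixedPartial_eq_iterDeriv hH hAl _ hx, ← hAσ] at this

end GroundProperty

/-- The growth rate of the exponent: `(c (k + 1)) ^ (3 k) = 2 ^ O(k log k)`. -/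
theorem isBigO_mul_logb {c : ℝ} (hc : 1 ≤ c) :
    (fun k : ℕ => 3 * (k : ℝ) * Real.logb 2 (c * (k + 1))) =O[atTop]
      fun k : ℕ => (k : ℝ) * Real.log k := by
  refine IsBigO.of_bound (9 / Real.log 2) ?_
  filter_upwards [eventually_ge_atTop 2, eventually_ge_atTop ⌈c⌉₊] with k hk2 hkc
  have hk : (2 : ℝ) ≤ k := by exact_mod_cast hk2
  have hck : c ≤ k := Nat.ceil_le.1 hkc
  have hlog2 : 0 < Real.log 2 := Real.log_pos (by norm_num)
  have hlogk : 0 ≤ Real.log k := Real.log_nonneg (by linarith)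
  -- for `k ≥ max c 2` one has `c (k + 1) ≤ k ^ 3`
  have h1 : Real.log (c * (k + 1)) ≤ 3 * Real.log k := by
    rw [← Nat.cast_ofNat, ← Real.log_pow]
    refine Real.log_le_log (by positivity) ?_
    calc c * (k + 1) ≤ (k : ℝ) * (k * k) := by gcongr; nlinarith
      _ = (k : ℝ) ^ 3 := by ring
  have h0 : 0 ≤ Real.log (c * (k + 1)) := Real.log_nonneg (by nlinarith)
  rw [Real.norm_of_nonneg (by unfold Real.logb; positivity), Real.norm_of_nonneg (by positivity),
    Real.logb]
  calc 3 * (k : ℝ) * (Real.log (c * (k + 1)) / Real.log 2)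
      ≤ 3 * (k : ℝ) * (3 * Real.log k / Real.log 2) := by gcongr
    _ = _ := by ring

end GroundState

theorem mainTheorem9 (γ : ℝ) (hγ : 0 < γ) :
    ∃ g : ℕ → ℝ, (g =O[atTop] fun k : ℕ => (k : ℝ) * Real.log k) ∧
      ∀ (n m k : ℕ) (H : (Fin m → ℝ) → GroundState.QubitOp n)
        (P : Fin n → GroundState.Pauli) (α : ℝ),
        ContDiffOn ℝ k H (GroundState.cube m) →
        (∀ x ∈ GroundState.cube m, (H x).IsHermitian) →
        (∀ x ∈ GroundState.cube m, GroundState.HasSpectralGap (H x) γ) →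
        ContDiffOn ℝ k (GroundState.groundProperty H P α) (GroundState.cube m) ∧
        (∀ i : Fin k → Fin m,
          (∀ l : ℕ, 1 ≤ l → ∀ σ : Fin l ↪o Fin k, ∀ x ∈ GroundState.cube m,
            ‖GroundState.mixedPartial H (i ∘ σ) x‖ ≤ 1) →
          ∀ x ∈ GroundState.cube m,
            ‖GroundState.mixedPartial (GroundState.groundProperty H P α) i x‖
              ≤ |α| * (2 : ℝ) ^ g k) ∧
        ((∀ l : ℕ, 1 ≤ l → l ≤ k → GroundState.sobolevSeminorm l H ≤ 1) →
          GroundState.sobolevNorm k (GroundState.groundProperty H P α)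
            ≤ ENNReal.ofReal (|α| * (2 : ℝ) ^ g k)) := by
  have hγ' : 0 < γ⁻¹ := inv_pos.2 hγ
  have hpow : ∀ k : ℕ, (2 : ℝ) ^ (3 * (k : ℝ) * Real.logb 2 ((2 + 4 * γ⁻¹) * (k + 1))) =
      ((2 + 4 * γ⁻¹) * (k + 1)) ^ (3 * k) := by
    intro k
    rw [mul_comm, Real.rpow_mul (by norm_num), Real.rpow_logb (by norm_num) (by norm_num)
      (by positivity), ← Real.rpow_natCast]
    push_cast
    rfl
  refine ⟨fun k => 3 * (k : ℝ) * Real.logb 2 ((2 + 4 * γ⁻¹) * (k + 1)),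
    GroundState.isBigO_mul_logb (by linarith), ?_⟩
  intro n m k H P α hH hherm hgap
  refine ⟨GroundState.contDiffOn_groundProperty hγ P α hH hherm hgap, ?_, ?_⟩
  · intro i hi x hx
    beta_reduce
    rw [hpow]
    exact GroundState.norm_mixedPartial_groundProperty_le hγ P α hH hherm hgap hx le_rfl i
      fun j hj σ => hi j hj σ x hx
  · intro hW
    beta_reduce
    rw [hpow]
    refine iSup₂_le fun l hl => iSup_le fun i => iSup₂_le fun x hx => ?_
    rw [← ofReal_norm]
    refine ENNReal.ofReal_le_ofReal ?_
    refine GroundState.norm_mixedPartial_groundProperty_le hγ P α hH hherm hgap hx hl i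
      fun j hj σ => ?_
    have hjl : j ≤ l := by simpa using Fintype.card_le_of_embedding σ.toEmbedding
    have h1 : ‖GroundState.mixedPartial H (i ∘ σ) x‖ₑ ≤ GroundState.sobolevSeminorm j H :=
      (le_iSup₂ (f := fun y (_ : y ∈ GroundState.cube m) =>
        ‖GroundState.mixedPartial H (i ∘ σ) y‖ₑ) x hx).trans
        (le_iSup (fun i' : Fin j → Fin m => ⨆ y ∈ GroundState.cube m,
          ‖GroundState.mixedPartial H i' y‖ₑ) (i ∘ σ))
    have h2 := h1.trans (hW j hj (hjl.trans hl))
    rwa [← ofReal_norm, ENNReal.ofReal_le_one] at h2
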